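/- An energy harvesting transmitter has energy arrivals $E_0,\dots,E_N\ge 0$ at times $0=s_0<s_1<\dots<s_N<D$, where $D$ is the deadline and $s_{N+1}=D$; the intervals $[s_i,s_{i+1}]$, $0\le i\le N$, are called epochs. Let $a,b\ge 0$ and $T_e<T_c$. A power policy $P:[0,D]\to[0,\infty)$, measurable, produces the temperature $T$ with $$\frac{dT}{dt}=aP(t)-b\,(T(t)-T_e),\quad T(0)=T_e,\qquad\text{i.e.}\qquad T(t)=e^{-bt}\Big(\int_0^t e^{b\tau}\big(aP(\tau)+bT_e\big)\,d\tau+T_e\Big).$$ It is feasible if $\int_0^tP(\tau)\,d\tau\le\sum_{i:\,s_i<t}E_i$ and $T(t)\le T_c$ for all $t\in[0,D]$, and optimal if it maximizes $\int_0^D\frac12\log_2(1+P(\tau))\,d\tau$ over all feasible policies. Let $P$ be an optimal policy, $T$ its temperature and $[s_i,s_{i+1}]$ an epoch. "Increasing" and "decreasing" are meant in the weak sense. (1) If $t_h,\,t_h+\Delta\in[s_i,s_{i+1}]$ with $\Delta>0$, $T(t_h)=T_c$ and $T(t_h+\Delta)<T_c$, then $T(t)<T_c$ for all $t\in[t_h+\Delta,s_{i+1}]$,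 and $T$ is decreasing on $[t_h,s_{i+1}]$. (2) If $T$ takes the value $T_c$ in $[s_i,s_{i+1}]$, then there are $s_i\le t_1\le t_2\le s_{i+1}$ such that $T$ is increasing on $[s_i,t_1]$ with $T<T_c$ on $[s_i,t_1)$, $T=T_c$ on $[t_1,t_2]$, and $T$ is decreasing on $[t_2,s_{i+1}]$ with $T<T_c$ on $(t_2,s_{i+1}]$. (3) If $T<T_c$ on $[s_i,s_{i+1}]$, then there is $t_1\in[s_i,s_{i+1}]$ such that $T$ is increasing on $[s_i,t_1]$ and decreasing on $[t_1,s_{i+1}]$. -/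

import Mathlib

open Set MeasureTheory

noncomputable section

/-- The data of an energy harvesting transmitter with temperature dynamics
`dT/dt = a P - b (T - Te)`.  Energy `E i` arrives at time `s i` for `i = 0, …, N`, where
`0 = s 0 < s 1 < ⋯ < s N`, and by convention `s (N + 1)` is the deadline `D`. -/
structure EHSystem where
  /-- heating coefficient -/
  a : ℝ
  /-- cooling coefficient -/
  b : ℝ
  /-- temperature of the environment, which is also the initial temperature -/
  Te : ℝ
  /-- critical temperature -/
  Tc : ℝ
  /-- number of energy arrivals after time `0` and before the deadline -/
  N : ℕ
  /-- arrival instants; the last entry is the deadline -/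
  s : Fin (N + 2) → ℝ
  /-- amounts of the arriving energy -/
  E : Fin (N + 1) → ℝ
  a_nonneg : 0 ≤ a
  b_nonneg : 0 ≤ b
  Te_lt_Tc : Te < Tc
  s_zero : s 0 = 0
  s_strictMono : StrictMono s
  E_nonneg : ∀ i, 0 ≤ E i

namespace EHSystem

/-- The deadline. -/
def D (M : EHSystem) : ℝ := M.s (Fin.last (M.N + 1))

/-- The `i`-th epoch `[s i, s (i + 1)]`, for `i = 0, …, N`. -/
def epoch (M : EHSystem) (i : Fin (M.N + 1)) : Set ℝ := Icc (M.s i.castSucc) (M.s i.succ)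

/-- Energy harvested strictly before time `t`, i.e. `E 0 + ⋯ + E k` with `k` the largest index
such that `s k < t`. -/
def harvested (M : EHSystem) (t : ℝ) : ℝ :=
  ∑ i : Fin (M.N + 1), if M.s i.castSucc < t then M.E i else 0

/-- Temperature at time `t ≥ 0` under the power policy `P`: the solution of
`dT/dt = a P - b (T - Te)` with initial condition `T 0 = Te`. -/
def temp (M : EHSystem) (P : ℝ → ℝ) (t : ℝ) : ℝ :=
  Real.exp (-M.b * t) *
    ((∫ τ in (0 : ℝ)..t, Real.exp (M.b * τ) * (M.a * P τ + M.b * M.Te)) + M.Te)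

/-- Feasible power policies: nonnegative measurable functions on `[0, D]` that satisfy the energy
causality and the temperature constraints.  Integrability is what the energy constraint at the
deadline says for a nonnegative measurable function. -/
structure IsFeasible (M : EHSystem) (P : ℝ → ℝ) : Prop where
  integrable : IntegrableOn P (Icc 0 M.D) volume
  nonneg : ∀ t ∈ Icc 0 M.D, 0 ≤ P t
  energy : ∀ t ∈ Icc 0 M.D, (∫ τ in (0 : ℝ)..t, P τ) ≤ M.harvested t
  temperature : ∀ t ∈ Icc 0 M.D, M.temp P t ≤ M.Tc

/-- Throughput over `[0, D]`. -/
def throughput (M : EHSystem) (P : ℝ → ℝ) : ℝ :=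
  ∫ τ in (0 : ℝ)..M.D, (1 / 2 : ℝ) * Real.logb 2 (1 + P τ)

/-- `P` is an optimal policy: feasible, and of maximal throughput among all feasible policies. -/
def IsOptimal (M : EHSystem) (P : ℝ → ℝ) : Prop :=
  M.IsFeasible P ∧ ∀ Q : ℝ → ℝ, M.IsFeasible Q → M.throughput Q ≤ M.throughput P

end EHSystem

end

/-! The whole statement reduces to one fact: on each epoch the temperature of an optimal policy is
quasiconcave (`IsOptimal.quasiconcaveOn_temp`). Since `Tc` bounds the temperature, every hitting
time of `Tc` is a maximum point, and a quasiconcave function increases up to a maximum point and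
decreases after it.

Suppose the temperature dips inside an epoch. Then on some `[α, β]` it equals `c` at both ends,
stays at most `c`, and is somewhere below. Replace `P` on `(α, β]` by its mean `p`. No energy
arrives inside an epoch, so energy causality survives. An integration by parts gives `a p ≤ b (c -
Te)`, so the new temperature stays at most `c` on `[α, β]` and below the old one afterwards: the new
policy is feasible (`IsFeasible.constOnIoc_mean`). Strict concavity of the rate and optimality force
`P = p` a.e. on `(α, β]` (`IsOptimal.ae_eq_mean`). Under constant power a temperature returning to
`c` never left it (`temp_eq_of_ae_const`), so there is no dip. -/

/-! ### Removing an exponential weight -/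

/-- If `t ↦ ∫ τ in α..t, exp (b τ) h τ` is nonpositive on `[α, β]` and vanishes at `β`, then the
unweighted integral of `h` is nonpositive too. -/
theorem integral_nonpos_of_exp_weighted {h : ℝ → ℝ} {α β b : ℝ} (hαβ : α ≤ β) (hb : 0 ≤ b)
    (hh : IntervalIntegrable h volume α β)
    (hG : ∀ t ∈ Icc α β, ∫ τ in α..t, Real.exp (b * τ) * h τ ≤ 0)
    (hGβ : ∫ τ in α..β, Real.exp (b * τ) * h τ = 0) :
    ∫ τ in α..β, h τ ≤ 0 := by
  have hi : IntervalIntegrable (fun τ => Real.exp (b * τ) * h τ) volume α β :=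
    hh.continuousOn_mul (by fun_prop)
  have hac := hi.absolutelyContinuousOnInterval_intervalIntegral (c := α) (by simp)
  have hexp : AbsolutelyContinuousOnInterval (fun τ => Real.exp (-b * τ)) α β :=
    ContDiffOn.absolutelyContinuousOnInterval (by fun_prop)
  have hparts := hexp.integral_mul_deriv_eq_deriv_mul hac
  have hleft : ∫ τ in α..β, Real.exp (-b * τ) *
      deriv (fun x => ∫ τ in α..x, Real.exp (b * τ) * h τ) τ = ∫ τ in α..β, h τ := by
    apply intervalIntegral.integral_congr_ae
    filter_upwards [hi.ae_hasDerivAt_integral] with x hx hxm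
    rw [(hx (uIoc_subset_uIcc hxm) α (by simp)).deriv, ← mul_assoc, ← Real.exp_add]
    simp
  have hderiv (τ : ℝ) : deriv (fun τ => Real.exp (-b * τ)) τ = -b * Real.exp (-b * τ) := by
    have : HasDerivAt (fun τ => Real.exp (-b * τ)) (Real.exp (-b * τ) * (-b)) τ :=
      HasDerivAt.exp (hasDerivAt_const_mul (-b))
    rw [this.deriv, mul_comm]
  have hright : 0 ≤ ∫ τ in α..β, deriv (fun τ => Real.exp (-b * τ)) τ *
      ∫ τ in α..τ, Real.exp (b * τ) * h τ := by
    refine intervalIntegral.integral_nonneg hαβ fun u hu => ?_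
    rw [hderiv]
    exact mul_nonneg_of_nonpos_of_nonpos
      (mul_nonpos_of_nonpos_of_nonneg (by linarith) (Real.exp_pos _).le) (hG u hu)
  rw [hleft, hGβ] at hparts
  simp only [mul_zero, intervalIntegral.integral_same, sub_zero, zero_sub] at hparts
  linarith

/-! ### The rate function -/

theorem continuous_half_logb_one_add_on :
    ContinuousOn (fun x : ℝ => (1 / 2 : ℝ) * Real.logb 2 (1 + x)) (Ici 0) := by
  refine ContinuousOn.const_mul ?_ _
  unfold Real.logb
  refine ContinuousOn.div_const (ContinuousOn.log (by fun_prop) ?_) _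
  intro x hx
  have : (0 : ℝ) ≤ x := hx
  positivity

theorem strictConcaveOn_half_logb_one_add :
    StrictConcaveOn ℝ (Ici 0) (fun x : ℝ => (1 / 2 : ℝ) * Real.logb 2 (1 + x)) := by
  refine ⟨convex_Ici 0, ?_⟩
  intro x hx y hy hxy u v hu hv huv
  have hx' : (0 : ℝ) ≤ x := hx
  have hy' : (0 : ℝ) ≤ y := hy
  have hlog := strictConcaveOn_log_Ioi.2 (x := 1 + x) (y := 1 + y)
    (show (0 : ℝ) < 1 + x by positivity) (show (0 : ℝ) < 1 + y by positivity)
    (by simpa using hxy) hu hv huv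
  have harg : u • (1 + x) + v • (1 + y) = 1 + (u • x + v • y) := by
    simp only [smul_eq_mul]
    linear_combination huv
  rw [harg] at hlog
  have h2 : 0 < Real.log 2 := Real.log_pos (by norm_num)
  simp only [smul_eq_mul, Real.logb] at hlog ⊢
  have := div_lt_div_of_pos_right hlog h2
  rw [add_div, mul_div_assoc, mul_div_assoc] at this
  linarith

theorem integrableOn_half_logb_one_add {P : ℝ → ℝ} {S : Set ℝ} (hS : MeasurableSet S)
    (hP : IntegrableOn P S) (hP0 : ∀ t ∈ S, 0 ≤ P t) :
    IntegrableOn (fun τ => (1 / 2 : ℝ) * Real.logb 2 (1 + P τ)) S := by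
  have hm : AEStronglyMeasurable (fun τ => Real.log (1 + P τ)) (volume.restrict S) :=
    (Real.measurable_log.comp_aemeasurable
      (hP.aestronglyMeasurable.aemeasurable.const_add 1)).aestronglyMeasurable
  have hlog : IntegrableOn (fun τ => Real.log (1 + P τ)) S := by
    refine Integrable.mono hP hm ?_
    filter_upwards [ae_restrict_mem hS] with t ht
    have h0 := hP0 t ht
    rw [Real.norm_of_nonneg (Real.log_nonneg (by linarith)), Real.norm_of_nonneg h0]
    have := Real.log_le_sub_one_of_pos (show 0 < 1 + P t by linarith)
    linarith
  exact (hlog.div_const (Real.log 2)).const_mul (1 / 2 : ℝ)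

/-! ### Dips and quasiconcavity on an interval -/

/-- A continuous function that dips strictly between two points below its values there does so on
a maximal interval with equal values at its ends. -/
theorem exists_dip_interval {f : ℝ → ℝ} {x y z : ℝ} (hf : ContinuousOn f (Icc x z))
    (hxy : x ≤ y) (hyz : y ≤ z) (hx : f y < f x) (hz : f y < f z) :
    ∃ α β, x ≤ α ∧ α < y ∧ y < β ∧ β ≤ z ∧ f β = f α ∧ f y < f α ∧
      ∀ t ∈ Icc α β, f t ≤ f α := by
  -- The lower of the two outer values is attained on both sides of `y`; `α` is the last such point
  -- before `y` and `β` the first after it.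
  set c := min (f x) (f z) with hc
  have hyc : f y < c := lt_min hx hz
  have hf1 : ContinuousOn f (Icc x y) := hf.mono (Icc_subset_Icc_right hyz)
  have hf2 : ContinuousOn f (Icc y z) := hf.mono (Icc_subset_Icc_left hxy)
  have hk1 : IsCompact (Icc x y ∩ f ⁻¹' {c}) :=
    isCompact_Icc.of_isClosed_subset (hf1.preimage_isClosed_of_isClosed isClosed_Icc
      isClosed_singleton) inter_subset_left
  have hk2 : IsCompact (Icc y z ∩ f ⁻¹' {c}) :=
    isCompact_Icc.of_isClosed_subset (hf2.preimage_isClosed_of_isClosed isClosed_Icc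
      isClosed_singleton) inter_subset_left
  obtain ⟨α, ⟨⟨hα1, hα2⟩, hα3⟩, hαmax⟩ := hk1.exists_isGreatest (by
    obtain ⟨t, ht, h⟩ := intermediate_value_Icc' hxy hf1 ⟨hyc.le, min_le_left _ _⟩
    exact ⟨t, ht, h⟩)
  obtain ⟨β, ⟨⟨hβ1, hβ2⟩, hβ3⟩, hβmin⟩ := hk2.exists_isLeast (by
    obtain ⟨t, ht, h⟩ := intermediate_value_Icc hyz hf2 ⟨hyc.le, min_le_right _ _⟩
    exact ⟨t, ht, h⟩)
  have hα3 : f α = c := hα3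
  have hβ3 : f β = c := hβ3
  have hαy : α < y := lt_of_le_of_ne hα2 (by rintro rfl; exact hyc.ne hα3)
  have hyβ : y < β := lt_of_le_of_ne hβ1 (by rintro rfl; exact hyc.ne hβ3)
  refine ⟨α, β, hα1, hαy, hyβ, hβ2, hβ3.trans hα3.symm, hα3 ▸ hyc, ?_⟩
  rw [hα3]
  rintro t ⟨hαt, htβ⟩
  -- A value above `c` would force another crossing of `c` between `t` and `y`, against the choice
  -- of `α` or `β`.
  by_contra! hct
  rcases le_total t y with hty | hyt
  · obtain ⟨u, hu, h⟩ := intermediate_value_Icc' hty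
      (hf1.mono (Icc_subset_Icc_left (hα1.trans hαt))) ⟨hyc.le, hct.le⟩
    have : u ≤ α := hαmax ⟨⟨by linarith [hu.1], hu.2⟩, h⟩
    have : t = α := le_antisymm (hu.1.trans this) hαt
    subst this
    exact hct.ne' hα3
  · obtain ⟨u, hu, h⟩ := intermediate_value_Icc hyt
      (hf2.mono (Icc_subset_Icc_right (htβ.trans hβ2))) ⟨hyc.le, hct.le⟩
    have : β ≤ u := hβmin ⟨⟨hu.1, by linarith [hu.2]⟩, h⟩
    have : t = β := le_antisymm htβ (this.trans hu.2)
    subst this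
    exact hct.ne' hβ3

theorem QuasiconcaveOn.min_le_of_mem_Icc {f : ℝ → ℝ} {s : Set ℝ} (hf : QuasiconcaveOn ℝ s f)
    {x y z : ℝ} (hx : x ∈ s) (hz : z ∈ s) (hy : y ∈ Icc x z) : min (f x) (f z) ≤ f y :=
  ((hf (min (f x) (f z))).ordConnected.out ⟨hx, min_le_left _ _⟩ ⟨hz, min_le_right _ _⟩ hy).2

theorem quasiconcaveOn_Icc_of_no_dip {f : ℝ → ℝ} {l r : ℝ}
    (h : ∀ x ∈ Icc l r, ∀ z ∈ Icc l r, ∀ y ∈ Icc x z, min (f x) (f z) ≤ f y) :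
    QuasiconcaveOn ℝ (Icc l r) f := by
  intro c
  refine OrdConnected.convex ⟨fun x hx z hz y hy => ⟨⟨hx.1.1.trans hy.1, hy.2.trans hz.1.2⟩, ?_⟩⟩
  exact (le_min hx.2 hz.2).trans (h x hx.1 z hz.1 y hy)

/-- When one end of a subinterval is the maximum point, the minimum of the two end values is the
value at the other end. -/
theorem QuasiconcaveOn.monotoneOn_antitoneOn_of_isMaxOn {f : ℝ → ℝ} {l r m : ℝ}
    (hf : QuasiconcaveOn ℝ (Icc l r) f) (hm : m ∈ Icc l r) (hmax : ∀ t ∈ Icc l r, f t ≤ f m) :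
    MonotoneOn f (Icc l m) ∧ AntitoneOn f (Icc m r) := by
  constructor
  · intro u hu v hv huv
    have hul : u ∈ Icc l r := ⟨hu.1, hu.2.trans hm.2⟩
    simpa [min_eq_left (hmax u hul)] using hf.min_le_of_mem_Icc hul hm ⟨huv, hv.2⟩
  · intro u hu v hv huv
    have hvr : v ∈ Icc l r := ⟨hm.1.trans hv.1, hv.2⟩
    simpa [min_eq_right (hmax v hvr)] using hf.min_le_of_mem_Icc hm hvr ⟨hu.1, huv⟩

/-! ### Replacing a policy by a constant on a subinterval -/

/-- The function equal to `p` on `(α, β]` and to `P` elsewhere. -/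
noncomputable def constOnIoc (P : ℝ → ℝ) (α β p : ℝ) (t : ℝ) : ℝ :=
  if α < t ∧ t ≤ β then p else P t

/-- The general integrand `F` lets the same lemma serve the energy, the heat and the throughput
integrals. -/
theorem integral_constOnIoc_congr {P : ℝ → ℝ} {α β p u v : ℝ} (huv : u ≤ v)
    (h : v ≤ α ∨ β ≤ u) (F : ℝ → ℝ → ℝ) :
    ∫ τ in u..v, F τ (constOnIoc P α β p τ) = ∫ τ in u..v, F τ (P τ) := by
  refine intervalIntegral.integral_congr_ae (ae_of_all _ fun τ hτ => ?_)
  rw [uIoc_of_le huv] at hτ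
  have : ¬(α < τ ∧ τ ≤ β) := by
    rintro ⟨h1, h2⟩
    rcases h with h | h <;> linarith [hτ.1, hτ.2]
  simp [constOnIoc, this]

theorem integral_constOnIoc_const {P : ℝ → ℝ} {α β p u v : ℝ} (hu : α ≤ u) (huv : u ≤ v)
    (hv : v ≤ β) (F : ℝ → ℝ → ℝ) :
    ∫ τ in u..v, F τ (constOnIoc P α β p τ) = ∫ τ in u..v, F τ p := by
  refine intervalIntegral.integral_congr_ae (ae_of_all _ fun τ hτ => ?_)
  rw [uIoc_of_le huv] at hτ
  have : α < τ ∧ τ ≤ β := ⟨by linarith [hτ.1], by linarith [hτ.2]⟩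
  simp [constOnIoc, this]

theorem integrableOn_constOnIoc {P : ℝ → ℝ} {S : Set ℝ} (hP : IntegrableOn P S) (α β p : ℝ) :
    IntegrableOn (constOnIoc P α β p) S := by
  have hc : IntegrableOn ((Ioc α β).indicator fun _ => p) S :=
    ((integrable_indicator_iff measurableSet_Ioc).2 (by simp)).integrableOn
  refine ((Integrable.sub hP (hP.indicator (measurableSet_Ioc (a := α) (b := β)))).add hc).congr
    (ae_of_all _ fun t => ?_)
  by_cases ht : t ∈ Ioc α β
  · simp [ht, constOnIoc, mem_Ioc.1 ht]
  · have ht' : ¬(α < t ∧ t ≤ β) := ht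
    simp [ht, constOnIoc, ht']

/-! ### Harvested energy and temperature -/

namespace EHSystem

variable (M : EHSystem) {P : ℝ → ℝ}

theorem s_nonneg (i : Fin (M.N + 2)) : 0 ≤ M.s i :=
  M.s_zero ▸ M.s_strictMono.monotone (Fin.zero_le i)

theorem s_le_D (i : Fin (M.N + 2)) : M.s i ≤ M.D :=
  M.s_strictMono.monotone (Fin.le_last i)

theorem epoch_subset (i : Fin (M.N + 1)) : M.epoch i ⊆ Icc 0 M.D :=
  Icc_subset_Icc (M.s_nonneg _) (M.s_le_D _)

/-- Arrivals count only strictly after their instant, so the harvested energy is constant on an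
epoch without its left end but with its right end. -/
theorem harvested_eq_of_mem {i : Fin (M.N + 1)} {t : ℝ} (h1 : M.s i.castSucc < t)
    (h2 : t ≤ M.s i.succ) : M.harvested t = M.harvested (M.s i.succ) := by
  refine Finset.sum_congr rfl fun j _ => ?_
  have : M.s j.castSucc < t ↔ M.s j.castSucc < M.s i.succ := by
    refine ⟨fun h => h.trans_le h2, fun h => ?_⟩
    have hji : j.castSucc < i.succ := M.s_strictMono.lt_iff_lt.1 h
    have : j.castSucc ≤ i.castSucc := by
      rw [Fin.lt_def] at hji
      rw [Fin.le_def]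
      simp at hji ⊢
      omega
    exact (M.s_strictMono.monotone this).trans_lt h1
  simp only [this]

variable {M}

theorem exp_mul_temp (t : ℝ) : Real.exp (M.b * t) * M.temp P t =
    (∫ τ in (0 : ℝ)..t, Real.exp (M.b * τ) * (M.a * P τ + M.b * M.Te)) + M.Te := by
  rw [temp, ← mul_assoc, ← Real.exp_add]
  simp

theorem intervalIntegrable_of_integrableOn {f : ℝ → ℝ} {D u v : ℝ} (hf : IntegrableOn f (Icc 0 D))
    (hu : u ∈ Icc 0 D) (hv : v ∈ Icc 0 D) : IntervalIntegrable f volume u v := by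
  rw [intervalIntegrable_iff]
  refine hf.mono_set ?_
  exact uIoc_subset_uIcc.trans (uIcc_subset_Icc hu hv)

theorem integral_exp_mul_const (b u v : ℝ) :
    ∫ τ in u..v, Real.exp (b * τ) * b = Real.exp (b * v) - Real.exp (b * u) := by
  refine intervalIntegral.integral_eq_sub_of_hasDerivAt (f := fun τ => Real.exp (b * τ))
    (fun x _ => HasDerivAt.exp (hasDerivAt_const_mul b)) ?_
  exact Continuous.intervalIntegrable (by fun_prop) _ _

theorem intervalIntegrable_heat {u v : ℝ} (h : IntervalIntegrable P volume u v) (k : ℝ) :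
    IntervalIntegrable (fun τ => Real.exp (M.b * τ) * (M.a * P τ + k)) volume u v :=
  ((h.const_mul M.a).add intervalIntegrable_const).continuousOn_mul (by fun_prop)

/-- Variation of constants between two instants, relative to a reference level `c`. -/
theorem exp_mul_temp_sub (hP : IntegrableOn P (Icc 0 M.D)) {u t : ℝ} (hu : u ∈ Icc 0 M.D)
    (ht : t ∈ Icc 0 M.D) (c : ℝ) :
    Real.exp (M.b * t) * (M.temp P t - c) = Real.exp (M.b * u) * (M.temp P u - c) +
      ∫ τ in u..t, Real.exp (M.b * τ) * (M.a * P τ + -(M.b * (c - M.Te))) := by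
  have h0 : (0 : ℝ) ∈ Icc 0 M.D := ⟨le_rfl, hu.1.trans hu.2⟩
  have hadd := intervalIntegral.integral_add_adjacent_intervals
    (intervalIntegrable_heat (M := M) (intervalIntegrable_of_integrableOn hP h0 hu) (M.b * M.Te))
    (intervalIntegrable_heat (M := M) (intervalIntegrable_of_integrableOn hP hu ht) (M.b * M.Te))
  have hsplit : ∫ τ in u..t, Real.exp (M.b * τ) * (M.a * P τ + -(M.b * (c - M.Te))) =
      (∫ τ in u..t, Real.exp (M.b * τ) * (M.a * P τ + M.b * M.Te)) -
        c * ∫ τ in u..t, Real.exp (M.b * τ) * M.b := by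
    rw [← intervalIntegral.integral_const_mul, ← intervalIntegral.integral_sub
      (intervalIntegrable_heat (intervalIntegrable_of_integrableOn hP hu ht) _)
      (Continuous.intervalIntegrable (by fun_prop) _ _)]
    congr 1
    funext τ
    ring
  rw [hsplit, integral_exp_mul_const, mul_sub, mul_sub, exp_mul_temp, exp_mul_temp, ← hadd]
  ring

theorem continuousOn_temp (hP : IntegrableOn P (Icc 0 M.D)) :
    ContinuousOn (M.temp P) (Icc 0 M.D) := by
  rcases le_or_gt 0 M.D with hD | hD
  · have h := intervalIntegrable_heat (M := M) (intervalIntegrable_of_integrableOn hP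
      ⟨le_rfl, hD⟩ ⟨hD, le_rfl⟩) (M.b * M.Te)
    have hc := intervalIntegral.continuousOn_primitive_interval' h (a := 0) (by simp)
    rw [uIcc_of_le hD] at hc
    exact ContinuousOn.mul (by fun_prop) (hc.add continuousOn_const)
  · simp [Icc_eq_empty hD.not_ge]

end EHSystem

/-! ### Flattening a dip of the temperature -/

namespace EHSystem
variable {M : EHSystem} {P : ℝ → ℝ}

theorem le_of_exp_mul_sub_nonpos {b x c t : ℝ} (h : Real.exp (b * t) * (x - c) ≤ 0) :
    x ≤ c := by
  have := nonpos_of_mul_nonpos_right h (Real.exp_pos _)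
  linarith

/-- Holding `P` at its mean over a stretch that starts and ends at temperature `c` and never
exceeds `c` does not call for more than the power that holds the temperature at `c`. -/
theorem mul_mean_le_of_temp_le (hP : IntegrableOn P (Icc 0 M.D)) {α β : ℝ} (hα : α ∈ Icc 0 M.D)
    (hβ : β ∈ Icc 0 M.D) (hαβ : α < β) (hend : M.temp P β = M.temp P α)
    (hle : ∀ t ∈ Icc α β, M.temp P t ≤ M.temp P α) :
    M.a * ((∫ τ in α..β, P τ) / (β - α)) ≤ M.b * (M.temp P α - M.Te) := by
  have hPi := intervalIntegrable_of_integrableOn hP hα hβ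
  have hint (t : ℝ) (ht : t ∈ Icc α β) := exp_mul_temp_sub hP hα
    (t := t) ⟨hα.1.trans ht.1, ht.2.trans hβ.2⟩ (M.temp P α)
  have key := integral_nonpos_of_exp_weighted (b := M.b)
    (h := fun τ => M.a * P τ + -(M.b * (M.temp P α - M.Te))) hαβ.le M.b_nonneg
    ((hPi.const_mul M.a).add intervalIntegrable_const)
    (fun t ht => by
      have h := hint t ht
      simp only [sub_self, mul_zero, zero_add] at h
      rw [← h]
      exact mul_nonpos_of_nonneg_of_nonpos (Real.exp_pos _).le (by linarith [hle t ht]))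
    (by
      have h := hint β ⟨hαβ.le, le_rfl⟩
      simp only [sub_self, mul_zero, zero_add, hend] at h
      exact h.symm)
  rw [intervalIntegral.integral_add (hPi.const_mul M.a) intervalIntegrable_const,
    intervalIntegral.integral_const_mul, intervalIntegral.integral_const, smul_eq_mul] at key
  rw [← mul_div_assoc, div_le_iff₀ (by linarith)]
  linarith

/-- Relative to the level at `α`, the weighted temperature is a nonnegative integral times `a p - b
(c - Te)`, with `c` the temperature at `α`. -/
theorem temp_constOnIoc_le (hP : IntegrableOn P (Icc 0 M.D)) {α β p : ℝ} (hα : α ∈ Icc 0 M.D)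
    (hβ : β ∈ Icc 0 M.D) (hp : M.a * p ≤ M.b * (M.temp P α - M.Te)) {t : ℝ}
    (ht : t ∈ Icc α β) : M.temp (constOnIoc P α β p) t ≤ M.temp P α := by
  have hα' : M.temp (constOnIoc P α β p) α = M.temp P α := by
    simp only [temp]
    rw [integral_constOnIoc_congr hα.1 (Or.inl le_rfl)
      (fun τ x => Real.exp (M.b * τ) * (M.a * x + M.b * M.Te))]
  have h := exp_mul_temp_sub (integrableOn_constOnIoc hP α β p) hα
    (t := t) ⟨hα.1.trans ht.1, ht.2.trans hβ.2⟩ (M.temp P α)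
  rw [hα', integral_constOnIoc_const le_rfl ht.1 ht.2
    (fun τ x => Real.exp (M.b * τ) * (M.a * x + -(M.b * (M.temp P α - M.Te)))),
    sub_self, mul_zero, zero_add, intervalIntegral.integral_mul_const] at h
  refine le_of_exp_mul_sub_nonpos (b := M.b) (t := t) ?_
  rw [h]
  exact mul_nonpos_of_nonneg_of_nonpos
    (intervalIntegral.integral_nonneg ht.1 fun u _ => (Real.exp_pos _).le) (by linarith)

theorem IsFeasible.constOnIoc_mean (hP : M.IsFeasible P) {i : Fin (M.N + 1)} {α β : ℝ}
    (hα : α ∈ M.epoch i) (hβ : β ∈ M.epoch i) (hαβ : α < β) (hend : M.temp P β = M.temp P α)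
    (hle : ∀ t ∈ Icc α β, M.temp P t ≤ M.temp P α) :
    M.IsFeasible (constOnIoc P α β ((∫ τ in α..β, P τ) / (β - α))) := by
  have hαD := M.epoch_subset i hα
  have hβD := M.epoch_subset i hβ
  set p := (∫ τ in α..β, P τ) / (β - α) with hp
  set Q := constOnIoc P α β p with hQ
  have hQi : IntegrableOn Q (Icc 0 M.D) := integrableOn_constOnIoc hP.integrable α β p
  have h0D : (0 : ℝ) ∈ Icc 0 M.D := ⟨le_rfl, hαD.1.trans hαD.2⟩
  have hp0 : 0 ≤ p := div_nonneg (intervalIntegral.integral_nonneg hαβ.le fun t ht =>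
    hP.nonneg t ⟨hαD.1.trans ht.1, ht.2.trans hβD.2⟩) (by linarith)
  have hQ0 : ∀ t ∈ Icc 0 M.D, 0 ≤ Q t := by
    intro t ht
    simp only [hQ, constOnIoc]
    split_ifs
    exacts [hp0, hP.nonneg t ht]
  have hmean : ∫ τ in α..β, Q τ = ∫ τ in α..β, P τ := by
    rw [hQ, integral_constOnIoc_const le_rfl hαβ.le le_rfl (fun _ x => x),
      intervalIntegral.integral_const, smul_eq_mul, hp, mul_div_cancel₀ _ (by linarith)]
  have hbefore {t : ℝ} (h0 : 0 ≤ t) (ht : t ≤ α) : ∫ τ in (0 : ℝ)..t, Q τ = ∫ τ in (0 : ℝ)..t, P τ :=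
    integral_constOnIoc_congr h0 (Or.inl ht) (fun _ x => x)
  have hafter {t : ℝ} (htD : t ≤ M.D) (ht : β ≤ t) :
      ∫ τ in (0 : ℝ)..t, Q τ = ∫ τ in (0 : ℝ)..t, P τ := by
    have htm : t ∈ Icc 0 M.D := ⟨hβD.1.trans ht, htD⟩
    have split {R : ℝ → ℝ} (hR : IntegrableOn R (Icc 0 M.D)) : ∫ τ in (0 : ℝ)..t, R τ =
        (∫ τ in (0 : ℝ)..α, R τ) + (∫ τ in α..β, R τ) + ∫ τ in β..t, R τ := by
      rw [intervalIntegral.integral_add_adjacent_intervals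
          (intervalIntegrable_of_integrableOn hR h0D hαD)
          (intervalIntegrable_of_integrableOn hR hαD hβD),
        intervalIntegral.integral_add_adjacent_intervals
          (intervalIntegrable_of_integrableOn hR h0D hβD)
          (intervalIntegrable_of_integrableOn hR hβD htm)]
    rw [split hQi, split hP.integrable, hbefore hαD.1 le_rfl, hmean,
      integral_constOnIoc_congr ht (Or.inr le_rfl) (fun _ x => x)]
  have hcool := mul_mean_le_of_temp_le hP.integrable hαD hβD hαβ hend hle
  refine ⟨hQi, hQ0, fun t ht => ?_, fun t ht => ?_⟩
  · rcases le_or_gt t α with htα | hαt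
    · rw [hbefore ht.1 htα]
      exact hP.energy t ht
    rcases le_or_gt β t with hβt | htβ
    · rw [hafter ht.2 hβt]
      exact hP.energy t ht
    -- Inside the stretch, the energy used by time `t` is at most that used by `β`, and the energy
    -- harvested by the two times is the same.
    have hadd := intervalIntegral.integral_add_adjacent_intervals
      (intervalIntegrable_of_integrableOn hQi h0D ht) (intervalIntegrable_of_integrableOn hQi ht hβD)
    have hrest : 0 ≤ ∫ τ in t..β, Q τ := intervalIntegral.integral_nonneg htβ.le fun u hu =>
      hQ0 u ⟨ht.1.trans hu.1, hu.2.trans hβD.2⟩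
    have hβe := hP.energy β hβD
    rw [← hafter hβD.2 le_rfl, M.harvested_eq_of_mem (hα.1.trans_lt hαβ) hβ.2,
      ← M.harvested_eq_of_mem (hα.1.trans_lt hαt) (htβ.le.trans hβ.2)] at hβe
    linarith
  · rcases le_or_gt t α with htα | hαt
    · have : M.temp Q t = M.temp P t := by
        simp only [temp]
        rw [hQ, integral_constOnIoc_congr ht.1 (Or.inl htα)
          (fun τ x => Real.exp (M.b * τ) * (M.a * x + M.b * M.Te))]
      rw [this]
      exact hP.temperature t ht
    rcases le_or_gt t β with htβ | hβt
    · exact (temp_constOnIoc_le hP.integrable hαD hβD hcool ⟨hαt.le, htβ⟩).trans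
        (hP.temperature α hαD)
    refine le_trans ?_ (hP.temperature t ht)
    -- After `β` both temperatures obey the same equation, so their order at `β` persists. The
    -- reference level is the old temperature at `t`.
    have hQt := exp_mul_temp_sub hQi hβD ht (M.temp P t)
    have hPt := exp_mul_temp_sub hP.integrable hβD ht (M.temp P t)
    rw [hQ, integral_constOnIoc_congr hβt.le (Or.inr le_rfl)
      (fun τ x => Real.exp (M.b * τ) * (M.a * x + -(M.b * (M.temp P t - M.Te)))), ← hQ] at hQt
    have hβle := temp_constOnIoc_le hP.integrable hαD hβD hcool (right_mem_Icc.2 hαβ.le)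
    rw [← hend] at hβle
    have := mul_le_mul_of_nonneg_left hβle (Real.exp_pos (M.b * β)).le
    refine le_of_exp_mul_sub_nonpos (b := M.b) (t := t) ?_
    rw [sub_self, mul_zero] at hPt
    linarith

/-- An optimal policy is constant wherever replacing it by its mean is feasible. -/
theorem IsOptimal.ae_eq_mean (hP : M.IsOptimal P) {α β : ℝ} (hα : α ∈ Icc 0 M.D)
    (hβ : β ∈ Icc 0 M.D) (hαβ : α < β)
    (hQ : M.IsFeasible (constOnIoc P α β ((∫ τ in α..β, P τ) / (β - α)))) :
    P =ᵐ[volume.restrict (Ioc α β)] fun _ => (∫ τ in α..β, P τ) / (β - α) := by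
  have hsub : Ioc α β ⊆ Icc 0 M.D := fun t ht => ⟨hα.1.trans ht.1.le, ht.2.trans hβ.2⟩
  have h0D : (0 : ℝ) ∈ Icc 0 M.D := ⟨le_rfl, hα.1.trans hα.2⟩
  have hDD : M.D ∈ Icc 0 M.D := ⟨h0D.2, le_rfl⟩
  have hav (f : ℝ → ℝ) : (⨍ τ in Ioc α β, f τ) = (∫ τ in α..β, f τ) / (β - α) := by
    rw [← uIoc_of_le hαβ.le, interval_average_eq_div]
  have hlogP := integrableOn_half_logb_one_add measurableSet_Icc hP.1.integrable hP.1.nonneg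
  have hlogQ := integrableOn_half_logb_one_add measurableSet_Icc hQ.integrable hQ.nonneg
  have hjensen := strictConcaveOn_half_logb_one_add.ae_eq_const_or_lt_map_average
    (μ := volume.restrict (Ioc α β)) (f := P) continuous_half_logb_one_add_on isClosed_Ici
    (by
      filter_upwards [ae_restrict_mem measurableSet_Ioc] with t ht
      exact hP.1.nonneg t (hsub ht))
    (hP.1.integrable.mono_set hsub) (hlogP.mono_set hsub)
  rw [hav] at hjensen
  -- Strict inequality in Jensen would give the averaged policy a larger throughput, since the two
  -- policies agree off `(α, β]`.
  refine hjensen.resolve_right fun hlt => ?_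
  rw [hav (fun τ => (1 / 2 : ℝ) * Real.logb 2 (1 + P τ)), div_lt_iff₀ (by linarith)] at hlt
  have hopt := hP.2 _ hQ
  set p := (∫ τ in α..β, P τ) / (β - α)
  have split {R : ℝ → ℝ} (hR : IntegrableOn R (Icc 0 M.D)) : ∫ τ in (0 : ℝ)..M.D, R τ =
      (∫ τ in (0 : ℝ)..α, R τ) + (∫ τ in α..β, R τ) + ∫ τ in β..M.D, R τ := by
    rw [intervalIntegral.integral_add_adjacent_intervals
        (intervalIntegrable_of_integrableOn hR h0D hα)
        (intervalIntegrable_of_integrableOn hR hα hβ),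
      intervalIntegral.integral_add_adjacent_intervals
        (intervalIntegrable_of_integrableOn hR h0D hβ)
        (intervalIntegrable_of_integrableOn hR hβ hDD)]
  rw [throughput, throughput, split hlogP, split hlogQ,
    integral_constOnIoc_congr hα.1 (Or.inl le_rfl)
      (fun _ x => (1 / 2 : ℝ) * Real.logb 2 (1 + x)),
    integral_constOnIoc_congr hβ.2 (Or.inr le_rfl)
      (fun _ x => (1 / 2 : ℝ) * Real.logb 2 (1 + x)),
    integral_constOnIoc_const le_rfl hαβ.le le_rfl
      (fun _ x => (1 / 2 : ℝ) * Real.logb 2 (1 + x)),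
    intervalIntegral.integral_const, smul_eq_mul] at hopt
  linarith

/-- Under constant power, a temperature that returns to its initial value never left it. -/
theorem temp_eq_of_ae_const (hP : IntegrableOn P (Icc 0 M.D)) {α β p : ℝ} (hα : α ∈ Icc 0 M.D)
    (hβ : β ∈ Icc 0 M.D) (hαβ : α < β) (hend : M.temp P β = M.temp P α)
    (hconst : P =ᵐ[volume.restrict (Ioc α β)] fun _ => p) {t : ℝ} (ht : t ∈ Icc α β) :
    M.temp P t = M.temp P α := by
  have hint {t : ℝ} (ht : t ∈ Icc α β) : Real.exp (M.b * t) * (M.temp P t - M.temp P α) =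
      (∫ τ in α..t, Real.exp (M.b * τ)) * (M.a * p + -(M.b * (M.temp P α - M.Te))) := by
    rw [exp_mul_temp_sub hP hα (t := t) ⟨hα.1.trans ht.1, ht.2.trans hβ.2⟩ (M.temp P α),
      sub_self, mul_zero, zero_add, ← intervalIntegral.integral_mul_const]
    refine intervalIntegral.integral_congr_ae ?_
    filter_upwards [(ae_restrict_iff' measurableSet_Ioc).1 hconst] with τ hτ hτm
    rw [uIoc_of_le ht.1] at hτm
    rw [hτ ⟨hτm.1, hτm.2.trans ht.2⟩]
  have hpos : 0 < ∫ τ in α..β, Real.exp (M.b * τ) :=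
    intervalIntegral.intervalIntegral_pos_of_pos
      (Continuous.intervalIntegrable (by fun_prop) _ _) (fun _ => Real.exp_pos _) hαβ
  -- At `t = β` the left side vanishes and the integral is positive, so the constant factor is zero,
  -- hence zero for all `t`.
  have hzero := hint (right_mem_Icc.2 hαβ.le)
  rw [hend, sub_self, mul_zero] at hzero
  have h := hint ht
  rw [(mul_eq_zero.1 hzero.symm).resolve_left hpos.ne', mul_zero] at h
  exact sub_eq_zero.1 ((mul_eq_zero.1 h).resolve_left (Real.exp_pos _).ne')

/-- The temperature of an optimal policy is quasiconcave on each epoch. -/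
theorem IsOptimal.quasiconcaveOn_temp (hP : M.IsOptimal P) (i : Fin (M.N + 1)) :
    QuasiconcaveOn ℝ (M.epoch i) (M.temp P) := by
  refine quasiconcaveOn_Icc_of_no_dip fun x hx z hz y hy => ?_
  by_contra! hlt
  have hsub : Icc x z ⊆ M.epoch i := Icc_subset_Icc hx.1 hz.2
  obtain ⟨α, β, hxα, hαy, hyβ, hβz, hend, hdip, hle⟩ := exists_dip_interval
    ((continuousOn_temp hP.1.integrable).mono (hsub.trans (M.epoch_subset i))) hy.1 hy.2
    (hlt.trans_le (min_le_left _ _)) (hlt.trans_le (min_le_right _ _))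
  have hαβ := hαy.trans hyβ
  have hα : α ∈ M.epoch i := hsub ⟨hxα, hαβ.le.trans hβz⟩
  have hβ : β ∈ M.epoch i := hsub ⟨hxα.trans hαβ.le, hβz⟩
  have hαD := M.epoch_subset i hα
  have hβD := M.epoch_subset i hβ
  have hconst := hP.ae_eq_mean hαD hβD hαβ (hP.1.constOnIoc_mean hα hβ hαβ hend hle)
  exact hdip.ne (temp_eq_of_ae_const hP.1.integrable hαD hβD hαβ hend hconst ⟨hαy.le, hyβ.le⟩)

end EHSystem

/-! ### The shape of the temperature on an epoch -/

theorem lemma20 (M : EHSystem) (P : ℝ → ℝ) (hP : M.IsOptimal P) (i : Fin (M.N + 1)) :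
    -- once the temperature touches `Tc` and is below `Tc` later in the epoch, it never returns to
    -- `Tc` in that epoch, and it is decreasing from the touching time on
    (∀ t_h Δ : ℝ, t_h ∈ M.epoch i → 0 < Δ → t_h + Δ ∈ M.epoch i →
      M.temp P t_h = M.Tc → M.temp P (t_h + Δ) < M.Tc →
        (∀ t ∈ Set.Icc (t_h + Δ) (M.s i.succ), M.temp P t < M.Tc) ∧
        AntitoneOn (M.temp P) (Set.Icc t_h (M.s i.succ))) ∧
    -- an epoch in which `Tc` is hit: increasing phase, phase at `Tc`, decreasing phase
    ((∃ t ∈ M.epoch i, M.temp P t = M.Tc) →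
      ∃ t₁ t₂ : ℝ, M.s i.castSucc ≤ t₁ ∧ t₁ ≤ t₂ ∧ t₂ ≤ M.s i.succ ∧
        MonotoneOn (M.temp P) (Set.Icc (M.s i.castSucc) t₁) ∧
        (∀ t ∈ Set.Ico (M.s i.castSucc) t₁, M.temp P t < M.Tc) ∧
        (∀ t ∈ Set.Icc t₁ t₂, M.temp P t = M.Tc) ∧
        AntitoneOn (M.temp P) (Set.Icc t₂ (M.s i.succ)) ∧
        (∀ t ∈ Set.Ioc t₂ (M.s i.succ), M.temp P t < M.Tc)) ∧
    -- an epoch in which `Tc` is not hit: increasing phase, then decreasing phase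
    ((∀ t ∈ M.epoch i, M.temp P t < M.Tc) →
      ∃ t₁ : ℝ, M.s i.castSucc ≤ t₁ ∧ t₁ ≤ M.s i.succ ∧
        MonotoneOn (M.temp P) (Set.Icc (M.s i.castSucc) t₁) ∧
        AntitoneOn (M.temp P) (Set.Icc t₁ (M.s i.succ))) := by
  have hq := hP.quasiconcaveOn_temp i
  have hcont : ContinuousOn (M.temp P) (M.epoch i) :=
    (EHSystem.continuousOn_temp hP.1.integrable).mono (M.epoch_subset i)
  have hTc : ∀ t ∈ M.epoch i, M.temp P t ≤ M.Tc := fun t ht =>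
    hP.1.temperature t (M.epoch_subset i ht)
  refine ⟨fun t_h Δ hth hΔ hthΔ heq hlt => ⟨fun t ht => ?_, ?_⟩, ?_, fun _ => ?_⟩
  -- The value at `t_h + Δ` is at least the smaller of the values at `t_h` and `t`; being below
  -- `Tc`, it must bound the one at `t`.
  · have htm : t ∈ M.epoch i := ⟨hthΔ.1.trans ht.1, ht.2⟩
    have := hq.min_le_of_mem_Icc hth htm (y := t_h + Δ) ⟨by linarith, ht.1⟩
    rw [heq, min_eq_right (hTc t htm)] at this
    exact this.trans_lt hlt
  · exact (hq.monotoneOn_antitoneOn_of_isMaxOn hth fun t ht => heq ▸ hTc t ht).2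
  · rintro ⟨t, ht, hteq⟩
    have hK : IsCompact (M.epoch i ∩ M.temp P ⁻¹' {M.Tc}) :=
      isCompact_Icc.of_isClosed_subset
        (hcont.preimage_isClosed_of_isClosed isClosed_Icc isClosed_singleton) inter_subset_left
    -- The first and last hitting times of `Tc`; between them quasiconcavity keeps the temperature
    -- at `Tc`.
    obtain ⟨t₁, ⟨h1m, h1⟩, h1min⟩ := hK.exists_isLeast ⟨t, ht, hteq⟩
    obtain ⟨t₂, ⟨h2m, h2⟩, h2max⟩ := hK.exists_isGreatest ⟨t, ht, hteq⟩
    have h1 : M.temp P t₁ = M.Tc := h1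
    have h2 : M.temp P t₂ = M.Tc := h2
    refine ⟨t₁, t₂, h1m.1, h1min ⟨h2m, h2⟩, h2m.2,
      (hq.monotoneOn_antitoneOn_of_isMaxOn h1m fun t ht => h1 ▸ hTc t ht).1, ?_, ?_,
      (hq.monotoneOn_antitoneOn_of_isMaxOn h2m fun t ht => h2 ▸ hTc t ht).2, ?_⟩
    · intro u hu
      have hum : u ∈ M.epoch i := ⟨hu.1, hu.2.le.trans h1m.2⟩
      exact lt_of_le_of_ne (hTc u hum) fun h => hu.2.not_ge (h1min ⟨hum, h⟩)
    · intro u hu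
      have := hq.min_le_of_mem_Icc h1m h2m hu
      rw [h1, h2, min_self] at this
      exact le_antisymm (hTc u ⟨h1m.1.trans hu.1, hu.2.trans h2m.2⟩) this
    · intro u hu
      have hum : u ∈ M.epoch i := ⟨h2m.1.trans hu.1.le, hu.2⟩
      exact lt_of_le_of_ne (hTc u hum) fun h => hu.1.not_ge (h2max ⟨hum, h⟩)
  · obtain ⟨m, hm, hmax⟩ := isCompact_Icc.exists_isMaxOn
      (nonempty_Icc.2 (M.s_strictMono.monotone (Fin.castSucc_lt_succ (i := i)).le)) hcont
    exact ⟨m, hm.1, hm.2, hq.monotoneOn_antitoneOn_of_isMaxOn hm fun t ht => hmax ht⟩
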